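/- Let $K$ be a field, let $k \ge 0$ and $m_1,\dots,m_k \ge 1$ be integers, put $n = m_1+\cdots+m_k$, and let $S = K[x_{i,j} \mid 1\le i\le k,\ 1\le j\le m_i]$ with its standard grading. Let $R = S/I_2(M)$ be the coordinate ring of the rational normal $k$-scroll $\mathcal S(m_1-1,\dots,m_k-1)$, where $I_2(M)$ is the ideal generated by the $2\times 2$ minors of the $2\times(n-k)$ matrix $$M=\left[\begin{array}{ccc|c|ccc} x_{1,1}&\cdots&x_{1,m_1-1}&\cdots&x_{k,1}&\cdots&x_{k,m_k-1}\\ x_{1,2}&\cdots&x_{1,m_1}&\cdots&x_{k,2}&\cdots&x_{k,m_k}\end{array}\right],$$ and let $D\subseteq S$ be the monomial ideal $$D=\langle x_{i,j}x_{i,\ell} \mid |j-\ell|\ge 2\rangle+\langle x_{i,j}x_{r,s}\mid 1\le i<r\le k,\ 1\le j<m_i,\ 1<s\le m_r\rangle .$$ For a homogeneous ideal $J$ of $S$ write $\operatorname{Hilb}(S/J;t)=\sum_{d\ge 0}\dim_K (S/J)_d\, t^d$. Then, as formal power series in $t$ with rational coefficients, $$\operatorname{Hilb}(R;-t)=\operatorname{Hilb}(S/D;-t)=\frac{1-(n-k-1)t}{(1+t)^{k+1}}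 .$$ In particular, these series depend only on $n$ and $k$. -/

import Mathlib

noncomputable section

namespace RationalNormalScroll

/-- The degree-`d` graded piece of `K[x_σ] / I` (for `I` a homogeneous ideal): the image in the
quotient of the space of homogeneous polynomials of degree `d`. -/
def gradedPiece {σ K : Type*} [Field K] (I : Ideal (MvPolynomial σ K)) (d : ℕ) :
    Submodule K (MvPolynomial σ K ⧸ I) :=
  (MvPolynomial.homogeneousSubmodule σ K d).map (Ideal.Quotient.mkₐ K I).toLinearMap

/-- With finitely many variables the graded pieces are finite-dimensional, so that
`Module.finrank` is their dimension. -/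
instance gradedPiece_finite {σ K : Type*} [Finite σ] [Field K] (I : Ideal (MvPolynomial σ K))
    (d : ℕ) : Module.Finite K (gradedPiece I d) :=
  Module.Finite.iff_fg.mpr ((MvPolynomial.homogeneousSubmodule_fg σ K d).map _)

/-- The Hilbert series `∑_d dim_K (K[x_σ] / I)_d t^d`, with coefficients regarded in `ℚ`. -/
def hilbertSeries {σ K : Type*} [Field K] (I : Ideal (MvPolynomial σ K)) : PowerSeries ℚ :=
  PowerSeries.mk fun d => (Module.finrank K (gradedPiece I d) : ℚ)

/-- The ideal generated by the `t × t` minors of a matrix. -/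
def minorIdeal {m n R : Type*} [CommRing R] (t : ℕ) (M : Matrix m n R) : Ideal R :=
  Ideal.span {f | ∃ (r : Fin t ↪ m) (c : Fin t ↪ n), f = (M.submatrix r c).det}

/-- Index set of the variables: the pair `⟨i, j⟩` (0-based) stands for `x_{i+1, j+1}`. -/
abbrev Var {k : ℕ} (m : Fin k → ℕ) : Type := Σ i : Fin k, Fin (m i)

/-- The scroll matrix, with two rows and one column for each pair `(x_{i,j}, x_{i,j+1})` of
consecutive variables in the same block. -/
def scrollMatrix (K : Type*) [Field K] {k : ℕ} (m : Fin k → ℕ) :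
    Matrix (Fin 2) (Σ i : Fin k, Fin (m i - 1)) (MvPolynomial (Var m) K) :=
  Matrix.of fun r c =>
    MvPolynomial.X ⟨c.1, ⟨c.2.val + r.val, by have := c.2.isLt; have := r.isLt; omega⟩⟩

/-- The ideal `I₂(M)` of the rational normal `k`-scroll `𝒮(m₁ - 1, …, m_k - 1)`. -/
def scrollIdeal (K : Type*) [Field K] {k : ℕ} (m : Fin k → ℕ) : Ideal (MvPolynomial (Var m) K) :=
  minorIdeal 2 (scrollMatrix K m)

/-- The monomial ideal `D`, generated by the `x_{i,j} x_{i,l}` with `|j - l| ≥ 2` and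
the `x_{i,j} x_{r,s}` with `i < r`, `j < m_i`, `1 < s` (in 1-based indices). -/
def diagonalIdeal (K : Type*) [Field K] {k : ℕ} (m : Fin k → ℕ) :
    Ideal (MvPolynomial (Var m) K) :=
  Ideal.span {f | ∃ (i : Fin k) (j l : Fin (m i)), 2 ≤ |(j.val : ℤ) - (l.val : ℤ)| ∧
      f = MvPolynomial.X ⟨i, j⟩ * MvPolynomial.X ⟨i, l⟩} ⊔
  Ideal.span {f | ∃ (i r : Fin k) (j : Fin (m i)) (s : Fin (m r)),
      i < r ∧ j.val + 1 < m i ∧ 0 < s.val ∧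
      f = MvPolynomial.X ⟨i, j⟩ * MvPolynomial.X ⟨r, s⟩}

end RationalNormalScroll

end

/-!
Both ideals have the same standard monomials, namely those not divisible by a generator of the
diagonal ideal `D`. For `S / D` these trivially give a basis (`finrank_gradedPiece_diagonalIdeal`).

For the scroll, the generators of `D` are the main diagonals of the minors. Replacing a diagonal
product by the antidiagonal one is a congruence modulo `I₂(M)` and lowers a suitable linear weight,
so every monomial is congruent to a standard one (`exists_standard_sub_mem_scrollIdeal`). They are
linearly independent modulo `I₂(M)` because the toric parametrization `x_{i,j} ↦ y_i s ^ j` kills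
the minors and sends distinct standard monomials to distinct monomials
(`Standard.eq_of_toricExp_eq`).

The same parametrization counts the standard monomials of degree `d`: their images are the monomials
`y ^ a s ^ w` with `|a| = d` and `w ≤ ∑ aᵢ (mᵢ - 1)` (`card_standardExps`). Summing
`1 + ∑ aᵢ (mᵢ - 1)` over all `a` gives the series `1 / (1 - t) ^ k + (n - k) t / (1 - t) ^ (k + 1)`
(`mk_sum_finsuppAntidiag`), which is `(1 + (n - k - 1) t) / (1 - t) ^ (k + 1)`.
-/

namespace RationalNormalScroll

open MvPolynomial

/-! ### Dimensions of graded pieces from standard monomials -/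

/-- If every monomial of degree `d` is congruent modulo `I` to zero or to a monomial with exponent in
`B`, and no nonzero polynomial with support in `B` lies in `I`, then the classes of those monomials
form a basis of the graded piece. -/
theorem finrank_gradedPiece_eq_card {σ K : Type*} [Field K] (I : Ideal (MvPolynomial σ K)) (d : ℕ)
    (B : Finset (σ →₀ ℕ)) (hB : ∀ b ∈ B, b.degree = d)
    (hspan : ∀ e : σ →₀ ℕ, e.degree = d → monomial e (1 : K) ∈ I ∨
      ∃ b ∈ B, monomial e (1 : K) - monomial b 1 ∈ I)
    (hind : ∀ f ∈ I, f.support ⊆ B → f = 0) :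
    Module.finrank K (gradedPiece I d) = B.card := by
  let v : B → MvPolynomial σ K ⧸ I := fun b => Ideal.Quotient.mkₐ K I (monomial b.1 1)
  have hv : LinearIndependent K v := by
    rw [Fintype.linearIndependent_iff]
    intro g hg b
    have hmem : ∑ b : B, monomial b.1 (g b) ∈ I := by
      rw [← Ideal.Quotient.eq_zero_iff_mem, ← Ideal.Quotient.mkₐ_eq_mk K, map_sum, ← hg]
      refine Finset.sum_congr rfl fun b _ => ?_
      rw [← map_smul, smul_monomial, smul_eq_mul, mul_one]
    have hzero := hind _ hmem fun e he => by
      classical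
      obtain ⟨b, -, hb⟩ := Finset.mem_biUnion.mp (support_sum he)
      rw [Finset.mem_singleton.mp (support_monomial_subset hb)]
      exact b.2
    have hc := congrArg (coeff b.1) hzero
    classical
    simpa [coeff_sum, coeff_monomial, Subtype.coe_inj] using hc
  have hrange : gradedPiece I d = Submodule.span K (Set.range v) := by
    apply le_antisymm
    · rintro _ ⟨p, hp, rfl⟩
      rw [SetLike.mem_coe, mem_homogeneousSubmodule] at hp
      rw [p.as_sum, map_sum]
      refine Submodule.sum_mem _ fun e he => ?_
      have hdeg : e.degree = d := by
        by_contra hne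
        exact mem_support_iff.mp he (hp.coeff_eq_zero hne)
      have hmon : monomial e (coeff e p) = coeff e p • monomial e (1 : K) := by
        rw [smul_monomial, smul_eq_mul, mul_one]
      rw [hmon, map_smul]
      refine Submodule.smul_mem _ _ ?_
      rcases hspan e hdeg with h | ⟨b, hb, h⟩
      · have h0 : Ideal.Quotient.mkₐ K I (monomial e 1) = 0 :=
          Ideal.Quotient.eq_zero_iff_mem.mpr h
        rw [AlgHom.toLinearMap_apply, h0]
        exact Submodule.zero_mem _
      · have h1 : Ideal.Quotient.mkₐ K I (monomial e 1) = v ⟨b, hb⟩ :=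
          Ideal.Quotient.eq.mpr h
        rw [AlgHom.toLinearMap_apply, h1]
        exact Submodule.subset_span ⟨_, rfl⟩
    · rw [Submodule.span_le]
      rintro _ ⟨b, rfl⟩
      exact ⟨_, isHomogeneous_monomial 1 (hB b.1 b.2), rfl⟩
  rw [hrange, finrank_span_eq_card hv, Fintype.card_coe]

/-! ### The generating function of the fibres -/

open PowerSeries in
theorem mk_natCast_eq : (PowerSeries.mk fun n => (n : ℚ)) = PowerSeries.X * (PowerSeries.mk 1) ^ 2 := by
  rw [mk_one_pow_eq_mk_choose_add ℚ 1]
  ext n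
  cases n with
  | zero => simp
  | succ n => simp [coeff_succ_X_mul, add_comm]

/-- The exponents `a` of degree `d` in `k` variables, counted with multiplicity `1 + ∑ aᵢ cᵢ`: the
multiplicity is linear in `a`, and each factor `aᵢ` turns one geometric series `1 / (1 - t)` into
`t / (1 - t)²`. -/
theorem mk_sum_finsuppAntidiag {k : ℕ} (c : Fin k → ℕ) :
    (PowerSeries.mk fun d => ((∑ a ∈ Finset.finsuppAntidiag (Finset.univ : Finset (Fin k)) d,
      (1 + ∑ i, a i * c i) : ℕ) : ℚ)) =
    (PowerSeries.mk 1) ^ k +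
      PowerSeries.C ((∑ i, c i : ℕ) : ℚ) * (PowerSeries.X * (PowerSeries.mk 1) ^ (k + 1)) := by
  have hconst : (PowerSeries.mk 1 : PowerSeries ℚ) ^ k =
      ∏ _i : Fin k, (PowerSeries.mk 1 : PowerSeries ℚ) := by simp
  have hlin : ∀ i : Fin k, PowerSeries.X * (PowerSeries.mk 1 : PowerSeries ℚ) ^ (k + 1) =
      ∏ j : Fin k, if j = i then PowerSeries.mk (fun n => (n : ℚ)) else PowerSeries.mk 1 := by
    intro i
    rw [← Finset.mul_prod_erase _ _ (Finset.mem_univ i), if_pos rfl, mk_natCast_eq,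
      Finset.prod_congr rfl (g := fun _ => (PowerSeries.mk 1 : PowerSeries ℚ))
        (fun j hj => if_neg (Finset.ne_of_mem_erase hj)), Finset.prod_const,
      Finset.card_erase_of_mem (Finset.mem_univ i), Finset.card_univ, Fintype.card_fin, mul_assoc,
      ← pow_add]
    have := i.pos
    congr 2
    omega
  have hcoef : ∀ (i : Fin k) (d : ℕ), PowerSeries.coeff d
      (PowerSeries.X * (PowerSeries.mk 1 : PowerSeries ℚ) ^ (k + 1)) =
      ∑ a ∈ Finset.finsuppAntidiag (Finset.univ : Finset (Fin k)) d, (a i : ℚ) := by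
    intro i d
    rw [hlin i, PowerSeries.coeff_prod]
    refine Finset.sum_congr rfl fun a _ => ?_
    rw [← Finset.mul_prod_erase _ _ (Finset.mem_univ i), if_pos rfl, PowerSeries.coeff_mk,
      Finset.prod_eq_one, mul_one]
    intro j hj
    rw [if_neg (Finset.ne_of_mem_erase hj), PowerSeries.coeff_mk, Pi.one_apply]
  ext d
  rw [PowerSeries.coeff_mk, map_add, PowerSeries.coeff_C_mul, hconst, PowerSeries.coeff_prod]
  push_cast
  rw [Finset.sum_add_distrib, Finset.sum_comm, Finset.sum_mul]
  congr 1
  · simp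
  · refine Finset.sum_congr rfl fun i _ => ?_
    rw [hcoef i, ← Finset.sum_mul, mul_comm]

/-! ### Standard monomials and the toric grading -/

variable {k : ℕ} {m : Fin k → ℕ}

/-- `Crossing u v` says that `x_u x_v` is one of the generators of the diagonal ideal; equivalently,
the main diagonal of the minor on the column starting at `u` and the column ending at `v`, where the
first column is to the left of the second. -/
def Crossing (u v : Var m) : Prop :=
  u.2.val + 1 < m u.1 ∧ 0 < v.2.val ∧ (u.1 < v.1 ∨ (u.1 = v.1 ∧ u.2.val + 2 ≤ v.2.val))

theorem Crossing.single_add_single_le {u v : Var m} (h : Crossing u v) {e : Var m →₀ ℕ}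
    (hu : e u ≠ 0) (hv : e v ≠ 0) : Finsupp.single u 1 + Finsupp.single v 1 ≤ e := by
  classical
  have huv : u ≠ v := by
    rintro rfl
    rcases h.2.2 with h | h
    · exact lt_irrefl _ h
    · omega
  intro x
  simp only [Finsupp.add_apply, Finsupp.single_apply]
  split_ifs with h₁ h₂ h₂
  · exact absurd (h₁.trans h₂.symm) huv
  · subst h₁
    omega
  · subst h₂
    omega
  · omega

/-- An exponent is standard if no generator of the diagonal ideal divides its monomial. -/
def Standard (e : Var m →₀ ℕ) : Prop :=
  ∀ u v : Var m, Crossing u v → e u = 0 ∨ e v = 0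

/-- The exponent of the image of a monomial under the toric parametrization
`x_{i,j} ↦ y_i s ^ j` of the scroll, with `j` counted from `0`; `none` stands for the variable
`s` and `some i` for `y_i`. -/
noncomputable def toricExp : (Var m →₀ ℕ) →ₗ[ℕ] (Option (Fin k) →₀ ℕ) :=
  Finsupp.linearCombination ℕ fun v =>
    Finsupp.single (some v.1) 1 + Finsupp.single none v.2.val

theorem toricExp_single (v : Var m) (c : ℕ) :
    toricExp (Finsupp.single v c) =
      c • (Finsupp.single (some v.1) 1 + Finsupp.single none v.2.val) :=
  Finsupp.linearCombination_single ..

theorem toricExp_some (e : Var m →₀ ℕ) (i : Fin k) : toricExp e (some i) = ∑ j, e ⟨i, j⟩ := by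
  rw [toricExp, Finsupp.linearCombination_apply, Finsupp.sum_fintype _ _ (by simp),
    Finsupp.finsetSum_apply, Fintype.sum_sigma, Finset.sum_eq_single i]
  · simp
  · intro b _ hb
    simp [hb]
  · simp

theorem toricExp_none (e : Var m →₀ ℕ) : toricExp e none = ∑ i, ∑ j, e ⟨i, j⟩ * j.val := by
  rw [toricExp, Finsupp.linearCombination_apply, Finsupp.sum_fintype _ _ (by simp),
    Finsupp.finsetSum_apply, Fintype.sum_sigma]
  simp

theorem sum_toricExp_some (e : Var m →₀ ℕ) : ∑ i, toricExp e (some i) = e.degree := by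
  simp_rw [toricExp_some, Finsupp.degree_eq_sum, Fintype.sum_sigma]

/-- The linear weight that selects the diagonal terms of the minors as leading terms: its increment
along the columns of the scroll matrix increases from left to right, provided that `N` bounds the
block sizes. -/
noncomputable def diagWeight (N : ℕ) : (Var m →₀ ℕ) →ₗ[ℕ] ℕ :=
  Finsupp.linearCombination ℕ fun v => 2 * N * v.1.val * v.2.val + v.2.val ^ 2

theorem diagWeight_lt {N : ℕ} (hN : ∀ i, m i ≤ N) {u v u' v' : Var m} (h : Crossing u v)
    (hu : u'.1 = u.1 ∧ u'.2.val = u.2.val + 1) (hv : v'.1 = v.1 ∧ v'.2.val + 1 = v.2.val) :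
    diagWeight N (Finsupp.single u' 1 + Finsupp.single v' 1) <
      diagWeight N (Finsupp.single u 1 + Finsupp.single v 1) := by
  obtain ⟨i, j⟩ := u
  obtain ⟨r, s⟩ := v
  obtain ⟨i', j'⟩ := u'
  obtain ⟨r', s'⟩ := v'
  obtain ⟨rfl : i' = i, hj : j'.val = j.val + 1⟩ := hu
  obtain ⟨rfl : r' = r, hs : s'.val + 1 = s.val⟩ := hv
  obtain ⟨h1 : j.val + 1 < m i', -, h3 : i' < r' ∨ (i' = r' ∧ j.val + 2 ≤ s.val)⟩ := h
  simp only [diagWeight, map_add, Finsupp.linearCombination_single, one_smul, hj, ← hs]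
  rcases h3 with h3 | ⟨rfl, h4⟩
  · have h5 : N * (i'.val + 1) ≤ N * r'.val := Nat.mul_le_mul_left _ h3
    nlinarith [hN i']
  · nlinarith

/-! ### Straightening modulo the scroll ideal -/

/-- A monomial multiple of the minor on the column starting at `u` and the column ending at `v`. -/
theorem monomial_sub_mem_scrollIdeal (K : Type*) [Field K] {u v u' v' : Var m}
    (h : Crossing u v) (hu : u'.1 = u.1 ∧ u'.2.val = u.2.val + 1)
    (hv : v'.1 = v.1 ∧ v'.2.val + 1 = v.2.val) (e : Var m →₀ ℕ) :
    monomial (Finsupp.single u 1 + Finsupp.single v 1 + e) (1 : K) -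
      monomial (Finsupp.single u' 1 + Finsupp.single v' 1 + e) 1 ∈ scrollIdeal K m := by
  obtain ⟨i, j⟩ := u
  obtain ⟨r, s⟩ := v
  obtain ⟨i', j'⟩ := u'
  obtain ⟨r', s'⟩ := v'
  obtain ⟨rfl : i' = i, hj : j'.val = j.val + 1⟩ := hu
  obtain ⟨rfl : r' = r, hs : s'.val + 1 = s.val⟩ := hv
  obtain ⟨h1 : j.val + 1 < m i', h2, h3 : i' < r' ∨ (i' = r' ∧ j.val + 2 ≤ s.val)⟩ := h
  have hslt := s.isLt
  let c₀ : Σ i : Fin k, Fin (m i - 1) := ⟨i', j.val, by omega⟩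
  let c₁ : Σ i : Fin k, Fin (m i - 1) := ⟨r', s'.val, by omega⟩
  have hne : c₀ ≠ c₁ := by
    intro heq
    rcases h3 with h3 | ⟨h3, h4⟩
    · exact h3.ne (congrArg Sigma.fst heq)
    · have : j.val = s'.val := congrArg (fun c : Σ i : Fin k, Fin (m i - 1) => c.2.val) heq
      omega
  have hinj : Function.Injective ![c₀, c₁] := by
    intro a b hab
    fin_cases a <;> fin_cases b <;> simp_all [hne.symm]
  have hdet : (X ⟨i', j⟩ * X ⟨r', s⟩ - X ⟨i', j'⟩ * X ⟨r', s'⟩ : MvPolynomial (Var m) K) ∈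
      scrollIdeal K m := by
    refine Ideal.subset_span ⟨Function.Embedding.refl _, ⟨_, hinj⟩, ?_⟩
    rw [Matrix.det_fin_two]
    have e1 : (⟨j.val + 1, h1⟩ : Fin (m i')) = j' := Fin.ext hj.symm
    have e2 : (⟨s'.val + 1, by omega⟩ : Fin (m r')) = s := Fin.ext hs
    simp [scrollMatrix, c₀, c₁, e1, e2]
    ring
  have hmul := (scrollIdeal K m).mul_mem_left (monomial e 1) hdet
  convert hmul using 1
  simp only [X, monomial_mul, mul_sub, mul_one]
  rw [add_comm e, add_comm e]

/-- Each straightening step replaces the diagonal term of a minor by the antidiagonal one; it keeps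
the toric exponent and lowers the weight. -/
theorem exists_standard_sub_mem_scrollIdeal (K : Type*) [Field K] (e : Var m →₀ ℕ) :
    ∃ b, Standard b ∧ toricExp b = toricExp e ∧
      monomial e (1 : K) - monomial b 1 ∈ scrollIdeal K m := by
  obtain ⟨N, hN⟩ : ∃ N, ∀ i, m i ≤ N :=
    ⟨∑ i, m i, fun i => Finset.single_le_sum (fun _ _ => Nat.zero_le _) (Finset.mem_univ i)⟩
  induction hw : diagWeight N e using Nat.strong_induction_on generalizing e with
  | _ w ih =>
    by_cases hstd : Standard e
    · exact ⟨e, hstd, rfl, by simp⟩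
    · unfold Standard at hstd
      push Not at hstd
      obtain ⟨u, v, hc, hu, hv⟩ := hstd
      obtain ⟨e₀, rfl⟩ := exists_add_of_le (hc.single_add_single_le hu hv)
      let u' : Var m := ⟨u.1, u.2.val + 1, hc.1⟩
      let v' : Var m := ⟨v.1, v.2.val - 1, by omega⟩
      have hu' : u'.1 = u.1 ∧ u'.2.val = u.2.val + 1 := ⟨rfl, rfl⟩
      have hv' : v'.1 = v.1 ∧ v'.2.val + 1 = v.2.val := ⟨rfl, Nat.sub_add_cancel hc.2.1⟩
      have hlt := diagWeight_lt hN hc hu' hv'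
      obtain ⟨b, hb, hbt, hbI⟩ := ih (diagWeight N (Finsupp.single u' 1 + Finsupp.single v' 1 + e₀))
        (by rw [← hw, map_add, map_add _ _ e₀]; omega) _ rfl
      refine ⟨b, hb, hbt.trans ?_, ?_⟩
      · simp only [map_add, toricExp_single, one_smul]
        rw [← hv'.2]
        change Finsupp.single (some u.1) 1 + Finsupp.single none (u.2.val + 1) +
          (Finsupp.single (some v.1) 1 + Finsupp.single none v'.2.val) + _ = _
        simp only [Finsupp.single_add]
        abel
      · have := (scrollIdeal K m).add_mem (monomial_sub_mem_scrollIdeal K hc hu' hv' e₀) hbI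
        rwa [sub_add_sub_cancel] at this

/-! ### Standard exponents are determined by their toric exponent -/

/-- A sequence supported on two adjacent positions can be read off from its total and its first
moment by division with remainder. -/
theorem exists_eq_ite_of_adjacent {l : ℕ} (f : Fin l → ℕ)
    (hf : ∀ i j : Fin l, i.val + 2 ≤ j.val → f i = 0 ∨ f j = 0) (hpos : ∑ j, f j ≠ 0) :
    ∃ c r, r < ∑ j, f j ∧ ∑ j, f j * j.val = r + (∑ j, f j) * c ∧
      ∀ j, f j = if j.val = c then ∑ j, f j - r else if j.val = c + 1 then r else 0 := by
  classical
  have hex : ∃ c, ∃ h : c < l, f ⟨c, h⟩ ≠ 0 := by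
    obtain ⟨j, -, hj⟩ := Finset.exists_ne_zero_of_sum_ne_zero hpos
    exact ⟨j.val, j.isLt, hj⟩
  obtain ⟨c, ⟨hc, hfc⟩, hmin⟩ : ∃ c, (∃ h : c < l, f ⟨c, h⟩ ≠ 0) ∧
      ∀ j : Fin l, j.val < c → f j = 0 :=
    ⟨Nat.find hex, Nat.find_spec hex, fun j hj => by
      by_contra h
      exact Nat.find_min hex hj ⟨j.isLt, h⟩⟩
  have hsupp : ∀ j : Fin l, f j ≠ 0 → j.val = c ∨ j.val = c + 1 := by
    intro j hj
    have h1 : ¬ j.val < c := fun h => hj (hmin j h)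
    have h2 : ¬ c + 2 ≤ j.val := fun h => (hf ⟨c, hc⟩ j h).elim hfc hj
    omega
  let r := ∑ j : Fin l, if j.val = c + 1 then f j else 0
  have hsum : ∑ j, f j = f ⟨c, hc⟩ + r := by
    have h : ∀ j : Fin l, f j =
        (if j = ⟨c, hc⟩ then f j else 0) + if j.val = c + 1 then f j else 0 := by
      intro j
      by_cases hj : f j = 0
      · simp [hj]
      · rcases hsupp j hj with h | h
        · simp [h, Fin.ext_iff]
        · simp [h, Fin.ext_iff]
    rw [Finset.sum_congr rfl fun j _ => h j, Finset.sum_add_distrib]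
    simp [r]
  refine ⟨c, r, by omega, ?_, fun j => ?_⟩
  · rw [Finset.sum_mul, ← Finset.sum_add_distrib]
    refine Finset.sum_congr rfl fun j _ => ?_
    by_cases hj : f j = 0
    · simp [hj]
    · rcases hsupp j hj with h | h
      · simp [h]
      · simp [h]
        ring
  · split_ifs with h1 h2
    · have : j = ⟨c, hc⟩ := Fin.ext h1
      rw [hsum, this]
      omega
    · have h : ∀ x : Fin l, (x.val = c + 1) = (x = j) := by
        intro x
        rw [← h2, Fin.ext_iff]
      simp [r, h]
    · by_contra h
      rcases hsupp j h with h' | h'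
      · exact h1 h'
      · exact h2 h'

theorem eq_of_adjacent_of_sum_eq {l : ℕ} {f g : Fin l → ℕ}
    (hf : ∀ i j : Fin l, i.val + 2 ≤ j.val → f i = 0 ∨ f j = 0)
    (hg : ∀ i j : Fin l, i.val + 2 ≤ j.val → g i = 0 ∨ g j = 0)
    (h0 : ∑ j, f j = ∑ j, g j) (h1 : ∑ j, f j * j.val = ∑ j, g j * j.val) : f = g := by
  by_cases hz : ∑ j, f j = 0
  · have hz' := h0.symm.trans hz
    rw [Finset.sum_eq_zero_iff] at hz hz'
    funext j
    rw [hz j (Finset.mem_univ j), hz' j (Finset.mem_univ j)]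
  · obtain ⟨c, r, hr, hm, hfj⟩ := exists_eq_ite_of_adjacent f hf hz
    obtain ⟨c', r', hr', hm', hgj⟩ := exists_eq_ite_of_adjacent g hg (h0 ▸ hz)
    have hpos := Nat.pos_of_ne_zero hz
    rw [← h0] at hr' hm'
    have hdm : r + (∑ j, f j) * c = r' + (∑ j, f j) * c' := by omega
    have hrr : r = r' := by
      have := congrArg (· % ∑ j, f j) hdm
      simpa [Nat.add_mul_mod_self_left, Nat.mod_eq_of_lt hr, Nat.mod_eq_of_lt hr'] using this
    subst hrr
    have hcc : c = c' := Nat.eq_of_mul_eq_mul_left hpos (by omega)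
    subst hcc
    funext j
    rw [hfj j, hgj j, h0]

theorem exists_lt_pred_of_sum_lt {l : ℕ} {f : Fin l → ℕ}
    (h : ∑ j, f j * j.val < (∑ j, f j) * (l - 1)) : ∃ j : Fin l, j.val + 1 < l ∧ f j ≠ 0 := by
  rw [Finset.sum_mul] at h
  obtain ⟨j, -, hj⟩ := Finset.exists_lt_of_sum_lt h
  have h1 : j.val < l - 1 := lt_of_mul_lt_mul_left hj (Nat.zero_le _)
  refine ⟨j, by omega, fun h0 => ?_⟩
  simp [h0] at hj

theorem exists_pos_of_sum_pos {l : ℕ} {f : Fin l → ℕ} (h : 0 < ∑ j, f j * j.val) :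
    ∃ j : Fin l, 0 < j.val ∧ f j ≠ 0 := by
  obtain ⟨j, -, hj⟩ := Finset.exists_ne_zero_of_sum_ne_zero h.ne'
  exact ⟨j, Nat.pos_of_ne_zero (right_ne_zero_of_mul hj), left_ne_zero_of_mul hj⟩

theorem sum_mul_val_le {l : ℕ} (f : Fin l → ℕ) :
    ∑ j, f j * j.val ≤ (∑ j, f j) * (l - 1) := by
  rw [Finset.sum_mul]
  exact Finset.sum_le_sum fun j _ => Nat.mul_le_mul_left _ (by omega)

/-- If `e` has smaller first moment than `b` in block `i` but larger in block `r`, then whichever of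
the two blocks comes first, `e` or `b` contains a crossing pair; so the block moments agree, and each
block, supported on two adjacent positions, is determined by its degree and moment. -/
theorem Standard.eq_of_toricExp_eq {e b : Var m →₀ ℕ} (he : Standard e) (hb : Standard b)
    (h : toricExp e = toricExp b) : e = b := by
  have h0 : ∀ i, ∑ j, e ⟨i, j⟩ = ∑ j, b ⟨i, j⟩ := fun i => by
    rw [← toricExp_some, ← toricExp_some, h]
  have hmom : ∀ i, ∑ j, e ⟨i, j⟩ * j.val = ∑ j, b ⟨i, j⟩ * j.val := by
    by_contra hne
    have htot : ∑ i, ∑ j, e ⟨i, j⟩ * j.val = ∑ i, ∑ j, b ⟨i, j⟩ * j.val := by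
      rw [← toricExp_none, ← toricExp_none, h]
    obtain ⟨i, hi⟩ : ∃ i, ∑ j, e ⟨i, j⟩ * j.val < ∑ j, b ⟨i, j⟩ * j.val := by
      by_contra hcon
      push Not at hcon hne
      exact hne.elim fun i hi => hi
        ((Finset.sum_eq_sum_iff_of_le fun i _ => hcon i).mp htot.symm i (Finset.mem_univ i)).symm
    obtain ⟨r, -, hr⟩ : ∃ r ∈ Finset.univ, ∑ j, b ⟨r, j⟩ * j.val < ∑ j, e ⟨r, j⟩ * j.val := by
      by_contra hcon
      push Not at hcon
      exact (Finset.sum_lt_sum hcon ⟨i, Finset.mem_univ i, hi⟩).ne htot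
    obtain ⟨j, hj, hej⟩ := exists_lt_pred_of_sum_lt (f := fun j => e ⟨i, j⟩)
      (hi.trans_le ((sum_mul_val_le _).trans_eq (by rw [h0])))
    obtain ⟨j', hj', hbj'⟩ := exists_pos_of_sum_pos (f := fun j => b ⟨i, j⟩)
      ((Nat.zero_le _).trans_lt hi)
    obtain ⟨s, hs, hbs⟩ := exists_lt_pred_of_sum_lt (f := fun j => b ⟨r, j⟩)
      (hr.trans_le ((sum_mul_val_le _).trans_eq (by rw [h0])))
    obtain ⟨s', hs', hes'⟩ := exists_pos_of_sum_pos (f := fun j => e ⟨r, j⟩)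
      ((Nat.zero_le _).trans_lt hr)
    rcases lt_trichotomy i r with hir | rfl | hir
    · exact (he ⟨i, j⟩ ⟨r, s'⟩ ⟨hj, hs', Or.inl hir⟩).elim hej hes'
    · exact lt_asymm hi hr
    · exact (hb ⟨r, s⟩ ⟨i, j'⟩ ⟨hs, hj', Or.inl hir⟩).elim hbs hbj'
  ext ⟨i, j⟩
  have hadj : ∀ {x : Var m →₀ ℕ}, Standard x → ∀ p q : Fin (m i), p.val + 2 ≤ q.val →
      x ⟨i, p⟩ = 0 ∨ x ⟨i, q⟩ = 0 := fun hx p q hpq =>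
    hx ⟨i, p⟩ ⟨i, q⟩ ⟨show p.val + 1 < m i by omega, show 0 < q.val by omega,
      Or.inr ⟨rfl, hpq⟩⟩
  exact congrFun (eq_of_adjacent_of_sum_eq (f := fun j => e ⟨i, j⟩) (g := fun j => b ⟨i, j⟩)
    (hadj he) (hadj hb) (h0 i) (hmom i)) j

/-! ### The toric exponents of a given degree -/

theorem toricExp_none_le (e : Var m →₀ ℕ) :
    toricExp e none ≤ ∑ i, toricExp e (some i) * (m i - 1) := by
  simp_rw [toricExp_none, toricExp_some]
  exact Finset.sum_le_sum fun i _ => sum_mul_val_le fun j => e ⟨i, j⟩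

/-- Start with all variables at the bottom of their blocks and raise the moment by moving one
variable up by one position at a time. -/
theorem exists_toricExp_eq (hm : ∀ i, 1 ≤ m i) (a : Fin k →₀ ℕ) (w : ℕ)
    (hw : w ≤ ∑ i, a i * (m i - 1)) :
    ∃ e : Var m →₀ ℕ, (∀ i, toricExp e (some i) = a i) ∧ toricExp e none = w := by
  classical
  induction w with
  | zero =>
    refine ⟨Finsupp.equivFunOnFinite.symm fun v => if v.2.val = 0 then a v.1 else 0, ?_, ?_⟩
    · intro i
      rw [toricExp_some, Finset.sum_eq_single ⟨0, hm i⟩]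
      · simp
      · intro j _ hj
        have : j.val ≠ 0 := fun h => hj (Fin.ext h)
        simp [this]
      · simp
    · rw [toricExp_none]
      refine Finset.sum_eq_zero fun i _ => Finset.sum_eq_zero fun j _ => ?_
      by_cases h : j.val = 0 <;> simp [h]
  | succ w ih =>
    obtain ⟨e, hea, hew⟩ := ih (by omega)
    have hlt : ∑ i, ∑ j, e ⟨i, j⟩ * j.val < ∑ i, (∑ j, e ⟨i, j⟩) * (m i - 1) := by
      rw [← toricExp_none, hew]
      simp_rw [← toricExp_some, hea]
      omega
    obtain ⟨i, -, hi⟩ := Finset.exists_lt_of_sum_lt hlt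
    obtain ⟨j, hj, hej⟩ := exists_lt_pred_of_sum_lt (f := fun j => e ⟨i, j⟩) hi
    have hle : Finsupp.single (⟨i, j⟩ : Var m) 1 ≤ e := by
      rw [Finsupp.single_le_iff]
      exact Nat.pos_of_ne_zero hej
    obtain ⟨e₀, rfl⟩ := exists_add_of_le hle
    have hstep : toricExp (Finsupp.single (⟨i, j.val + 1, hj⟩ : Var m) 1 + e₀) =
        toricExp (Finsupp.single (⟨i, j⟩ : Var m) 1 + e₀) + Finsupp.single none 1 := by
      simp only [map_add, toricExp_single, one_smul, Finsupp.single_add]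
      abel
    refine ⟨Finsupp.single (⟨i, j.val + 1, hj⟩ : Var m) 1 + e₀, fun i' => ?_, ?_⟩
    · rw [hstep, Finsupp.add_apply, hea]
      simp
    · rw [hstep, Finsupp.add_apply, hew]
      simp

open Classical in
/-- The standard exponents of degree `d`. -/
noncomputable def standardExps (m : Fin k → ℕ) (d : ℕ) : Finset (Var m →₀ ℕ) :=
  (Finset.finsuppAntidiag Finset.univ d).filter Standard

theorem mem_standardExps {d : ℕ} {e : Var m →₀ ℕ} :
    e ∈ standardExps m d ↔ e.degree = d ∧ Standard e := by
  simp [standardExps, Finsupp.degree_eq_sum]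

theorem card_standardExps (hm : ∀ i, 1 ≤ m i) (d : ℕ) :
    (standardExps m d).card = ∑ a ∈ Finset.finsuppAntidiag (Finset.univ : Finset (Fin k)) d,
      (1 + ∑ i, a i * (m i - 1)) := by
  have hcard : ∀ a : Fin k →₀ ℕ, 1 + ∑ i, a i * (m i - 1) =
      (Finset.range (1 + ∑ i, a i * (m i - 1))).card := fun a => (Finset.card_range _).symm
  rw [Finset.sum_congr rfl fun a _ => hcard a, ← Finset.card_sigma]
  refine Finset.card_bij (fun e _ => ⟨(toricExp e).some, toricExp e none⟩) ?_ ?_ ?_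
  · intro e he
    rw [mem_standardExps] at he
    have hle := toricExp_none_le e
    simp only [Finset.mem_sigma, Finset.mem_finsuppAntidiag, Finset.mem_range, Finsupp.some_apply,
      Finset.subset_univ, and_true]
    exact ⟨(sum_toricExp_some e).trans he.1, by omega⟩
  · intro e he b hb heq
    rw [mem_standardExps] at he hb
    refine he.2.eq_of_toricExp_eq hb.2 ?_
    simp only [Sigma.mk.injEq, heq_eq_eq] at heq
    ext x
    cases x with
    | none => exact heq.2
    | some i => exact DFunLike.congr_fun heq.1 i
  · rintro ⟨a, w⟩ haw
    simp only [Finset.mem_sigma, Finset.mem_finsuppAntidiag, Finset.mem_range,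
      Finset.subset_univ, and_true] at haw
    obtain ⟨e, hea, hew⟩ := exists_toricExp_eq hm a w (by omega)
    -- Straightening keeps the toric exponent; the field plays no role here.
    obtain ⟨b, hb, hbe, -⟩ := exists_standard_sub_mem_scrollIdeal ℚ e
    refine ⟨b, ?_, ?_⟩
    · rw [mem_standardExps, ← sum_toricExp_some, hbe]
      simp_rw [hea]
      exact ⟨haw.1, hb⟩
    · have hsome : (toricExp b).some = a := by
        ext i
        rw [Finsupp.some_apply, hbe, hea]
      rw [hsome, hbe, hew]

/-! ### The two Hilbert series -/

/-- The toric parametrization `x_{i,j} ↦ y_i s ^ j` of the scroll, as a map of polynomial rings. -/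
noncomputable def toricHom (K : Type*) [Field K] (m : Fin k → ℕ) :
    MvPolynomial (Var m) K →ₐ[K] MvPolynomial (Option (Fin k)) K :=
  aeval fun v => monomial (toricExp (Finsupp.single v 1)) 1

theorem toricHom_monomial (K : Type*) [Field K] (e : Var m →₀ ℕ) (c : K) :
    toricHom K m (monomial e c) = monomial (toricExp e) c := by
  rw [toricHom, aeval_monomial, Finsupp.prod]
  simp_rw [monomial_pow, one_pow]
  rw [← monomial_sum_one, algebraMap_eq, C_mul_monomial, mul_one]
  congr 1
  simp_rw [← map_nsmul, ← map_sum]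
  congr 1
  conv_rhs => rw [← Finsupp.sum_single e]
  simp [Finsupp.sum]

theorem scrollIdeal_le_ker_toricHom (K : Type*) [Field K] (m : Fin k → ℕ) :
    scrollIdeal K m ≤ RingHom.ker (toricHom K m) := by
  refine Ideal.span_le.mpr ?_
  rintro _ ⟨r, c, rfl⟩
  rw [SetLike.mem_coe, RingHom.mem_ker, Matrix.det_fin_two]
  simp only [Matrix.submatrix_apply, scrollMatrix, Matrix.of_apply, map_sub, X,
    toricHom_monomial, monomial_mul, mul_one]
  rw [sub_eq_zero]
  refine congrArg (fun e => monomial e (1 : K)) ?_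
  simp only [map_add, toricExp_single, one_smul, Finsupp.single_add]
  abel

theorem finrank_gradedPiece_scrollIdeal (K : Type*) [Field K] (m : Fin k → ℕ) (d : ℕ) :
    Module.finrank K (gradedPiece (scrollIdeal K m) d) = (standardExps m d).card := by
  refine finrank_gradedPiece_eq_card _ _ _ (fun b hb => (mem_standardExps.mp hb).1) ?_ ?_
  · intro e he
    obtain ⟨b, hb, hbe, hI⟩ := exists_standard_sub_mem_scrollIdeal K e
    refine Or.inr ⟨b, mem_standardExps.mpr ⟨?_, hb⟩, hI⟩
    rw [← he, ← sum_toricExp_some, hbe, sum_toricExp_some]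
  · intro f hf hsupp
    have hker : toricHom K m f = 0 := scrollIdeal_le_ker_toricHom K m hf
    rw [f.as_sum, map_sum] at hker
    simp_rw [toricHom_monomial] at hker
    rw [← support_eq_empty, Finset.eq_empty_iff_forall_notMem]
    intro e he
    have hc := congrArg (coeff (toricExp e)) hker
    classical
    rw [coeff_sum, Finset.sum_eq_single e, coeff_monomial, if_pos rfl, coeff_zero] at hc
    · exact mem_support_iff.mp he hc
    · intro b hb hbe
      rw [coeff_monomial, if_neg]
      exact fun heq => hbe ((mem_standardExps.mp (hsupp hb)).2.eq_of_toricExp_eq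
        (mem_standardExps.mp (hsupp he)).2 heq)
    · exact fun h => absurd he h

theorem diagonalIdeal_eq_span (K : Type*) [Field K] (m : Fin k → ℕ) :
    diagonalIdeal K m = Ideal.span ((fun e => monomial e (1 : K)) ''
      {e | ∃ u v : Var m, Crossing u v ∧ e = Finsupp.single u 1 + Finsupp.single v 1}) := by
  have hX : ∀ u v : Var m, (X u * X v : MvPolynomial (Var m) K) =
      monomial (Finsupp.single u 1 + Finsupp.single v 1) 1 := fun u v => by
    simp [X, monomial_mul]
  apply le_antisymm
  · refine sup_le (Ideal.span_le.mpr ?_) (Ideal.span_le.mpr ?_)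
    · rintro _ ⟨i, j, l, hjl, rfl⟩
      rcases le_abs.mp hjl with h | h
      · rw [mul_comm, hX]
        exact Ideal.subset_span ⟨_, ⟨⟨i, l⟩, ⟨i, j⟩, ⟨show l.val + 1 < m i by omega,
          show 0 < j.val by omega, Or.inr ⟨rfl, show l.val + 2 ≤ j.val by omega⟩⟩, rfl⟩, rfl⟩
      · rw [hX]
        exact Ideal.subset_span ⟨_, ⟨⟨i, j⟩, ⟨i, l⟩, ⟨show j.val + 1 < m i by omega,
          show 0 < l.val by omega, Or.inr ⟨rfl, show j.val + 2 ≤ l.val by omega⟩⟩, rfl⟩, rfl⟩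
    · rintro _ ⟨i, r, j, s, hir, hj, hs, rfl⟩
      rw [hX]
      exact Ideal.subset_span ⟨_, ⟨⟨i, j⟩, ⟨r, s⟩, ⟨hj, hs, Or.inl hir⟩, rfl⟩, rfl⟩
  · refine Ideal.span_le.mpr ?_
    rintro _ ⟨_, ⟨⟨i, j⟩, ⟨r, s⟩, ⟨hj, hs, h⟩, rfl⟩, rfl⟩
    change monomial _ _ ∈ _
    rw [← hX]
    rcases h with h | ⟨h, hjs⟩
    · exact Ideal.mem_sup_right (Ideal.subset_span ⟨i, r, j, s, h, hj, hs, rfl⟩)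
    · obtain rfl : i = r := h
      refine Ideal.mem_sup_left (Ideal.subset_span ⟨i, j, s, le_abs.mpr (Or.inr ?_), rfl⟩)
      have : j.val + 2 ≤ s.val := hjs
      omega

theorem mem_diagonalIdeal_iff {K : Type*} [Field K] {f : MvPolynomial (Var m) K} :
    f ∈ diagonalIdeal K m ↔ ∀ e ∈ f.support, ¬ Standard e := by
  rw [diagonalIdeal_eq_span, mem_ideal_span_monomial_image]
  refine forall₂_congr fun e _ => ?_
  unfold Standard
  push Not
  constructor
  · rintro ⟨_, ⟨u, v, hc, rfl⟩, hle⟩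
    refine ⟨u, v, hc, ?_, ?_⟩
    · have := hle u
      simp at this
      omega
    · have := hle v
      simp at this
      omega
  · rintro ⟨u, v, hc, hu, hv⟩
    exact ⟨_, ⟨u, v, hc, rfl⟩, hc.single_add_single_le hu hv⟩

theorem finrank_gradedPiece_diagonalIdeal (K : Type*) [Field K] (m : Fin k → ℕ) (d : ℕ) :
    Module.finrank K (gradedPiece (diagonalIdeal K m) d) = (standardExps m d).card := by
  refine finrank_gradedPiece_eq_card _ _ _ (fun b hb => (mem_standardExps.mp hb).1) ?_ ?_
  · intro e he
    by_cases hstd : Standard e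
    · exact Or.inr ⟨e, mem_standardExps.mpr ⟨he, hstd⟩, by simp⟩
    · refine Or.inl (mem_diagonalIdeal_iff.mpr fun x hx => ?_)
      rwa [Finset.mem_singleton.mp (support_monomial_subset hx)]
  · intro f hf hsupp
    rw [← support_eq_empty, Finset.eq_empty_iff_forall_notMem]
    exact fun e he => mem_diagonalIdeal_iff.mp hf e he (mem_standardExps.mp (hsupp he)).2

/-- The Hilbert series before the substitution `t ↦ -t`, with its denominator cleared. -/
theorem mk_card_standardExps_mul (hm : ∀ i, 1 ≤ m i) :
    (PowerSeries.mk fun d => ((standardExps m d).card : ℚ)) * (1 - PowerSeries.X) ^ (k + 1) =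
      1 + PowerSeries.C (((∑ i, m i : ℕ) : ℚ) - k - 1) * PowerSeries.X := by
  have hsum : ((∑ i, (m i - 1) : ℕ) : ℚ) = ((∑ i, m i : ℕ) : ℚ) - k := by
    push_cast
    rw [Finset.sum_congr rfl fun i _ => Nat.cast_pred (R := ℚ) (hm i)]
    simp
  simp_rw [card_standardExps hm]
  rw [mk_sum_finsuppAntidiag, hsum]
  have hG := PowerSeries.mk_one_mul_one_sub_eq_one ℚ
  have hGk : ∀ l, (PowerSeries.mk 1 : PowerSeries ℚ) ^ l * (1 - PowerSeries.X) ^ l = 1 := fun l => by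
    rw [← mul_pow, hG, one_pow]
  have h1 := hGk k
  have h2 := hGk (k + 1)
  rw [map_sub _ _ (1 : ℚ), map_one]
  linear_combination (1 - PowerSeries.X) * h1 +
    PowerSeries.C (((∑ i, m i : ℕ) : ℚ) - k) * PowerSeries.X * h2

end RationalNormalScroll

theorem proposition3p6 (K : Type*) [Field K] (k : ℕ) (m : Fin k → ℕ) (hm : ∀ i, 1 ≤ m i)
    (n : ℕ) (hn : n = ∑ i, m i) :
    PowerSeries.rescale (-1 : ℚ) (RationalNormalScroll.hilbertSeries (RationalNormalScroll.scrollIdeal K m)) =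
        PowerSeries.rescale (-1 : ℚ) (RationalNormalScroll.hilbertSeries (RationalNormalScroll.diagonalIdeal K m)) ∧
      PowerSeries.rescale (-1 : ℚ) (RationalNormalScroll.hilbertSeries (RationalNormalScroll.diagonalIdeal K m)) =
        (1 - PowerSeries.C ((n : ℚ) - (k : ℚ) - 1) * PowerSeries.X) *
          ((1 + PowerSeries.X) ^ (k + 1))⁻¹ := by
  simp only [RationalNormalScroll.hilbertSeries,
    RationalNormalScroll.finrank_gradedPiece_scrollIdeal,
    RationalNormalScroll.finrank_gradedPiece_diagonalIdeal, true_and]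
  rw [PowerSeries.eq_mul_inv_iff_mul_eq (by simp)]
  have h := congrArg (PowerSeries.rescale (-1 : ℚ))
    (RationalNormalScroll.mk_card_standardExps_mul hm)
  have hC : ∀ c : ℚ, PowerSeries.rescale (-1 : ℚ) (PowerSeries.C c) = PowerSeries.C c := by
    intro c
    ext i
    cases i <;> simp
  simpa [PowerSeries.rescale_neg_one_X, hC, hn, sub_eq_add_neg] using h
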